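/- An interval exchange transformation (IET) is a map $T:[0,1)\to[0,1)$ for which there are an integer $d\ge 1$, lengths $\lambda_1,\dots,\lambda_d>0$ with $\lambda_1+\cdots+\lambda_d=1$, and a permutation $\pi$ of $\{1,\dots,d\}$ such that, for each $i$, $$T(x)=x-\sum_{j<i}\lambda_j+\sum_{j:\,\pi(j)<\pi(i)}\lambda_j\qquad\text{for all } x\in\Big[\sum_{j<i}\lambda_j,\ \sum_{j\le i}\lambda_j\Big).$$ An invertible measure preserving transformation $S$ of a probability space $(Y,\mathfrak C,\nu)$ is called partially rigid if there are $\delta>0$ and a strictly increasing sequence $(m_n)_{n\ge1}$ of natural numbers such that $$\liminf_{n\to\infty}\nu(A\cap S^{m_n}A)\ge\delta\,\nu(A)\qquad\text{for each } A\in\mathfrak C.$$ **Proposition.** Let $T$ be an IET of $[0,1)$ that is ergodic with respect to Lebesgue measure on $[0,1)$. Then $T$, considered with Lebesgue measure, is partially rigid. -/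

import Mathlib

open MeasureTheory Filter Set
open scoped NNReal ENNReal

/-- Combinatorial data of an exchange of `d` intervals of `[0, 1)`: the lengths of the intervals,
listed from left to right, and the permutation describing their new order (the `i`-th interval
is moved to the position `perm i`). -/
structure IntervalExchangeData (d : ℕ) where
  /-- The lengths of the exchanged intervals, from left to right. -/
  length : Fin d → ℝ
  /-- The new position of each interval. -/
  perm : Equiv.Perm (Fin d)
  length_pos : ∀ i, 0 < length i
  sum_length : ∑ i, length i = 1

namespace IntervalExchangeData

variable {d : ℕ} (D : IntervalExchangeData d)

/-- The left endpoint of the `i`-th interval before the exchange. -/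
noncomputable def left (i : Fin d) : ℝ := ∑ j with j < i, D.length j

/-- The left endpoint of the `i`-th interval after the exchange. -/
noncomputable def newLeft (i : Fin d) : ℝ := ∑ j with D.perm j < D.perm i, D.length j

/-- The `i`-th interval `[left i, left i + length i)`. These intervals partition `[0, 1)`. -/
def interval (i : Fin d) : Set ℝ := Ico (D.left i) (D.left i + D.length i)

end IntervalExchangeData

/-- `T : [0, 1) → [0, 1)` is an interval exchange transformation: for some data as above, `T`
translates every interval to its new place. -/
def IsIntervalExchange (T : Ico (0 : ℝ) 1 → Ico (0 : ℝ) 1) : Prop :=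
  ∃ (d : ℕ) (D : IntervalExchangeData d), ∀ (i : Fin d) (x : Ico (0 : ℝ) 1),
    (x : ℝ) ∈ D.interval i → (T x : ℝ) = (x : ℝ) - D.left i + D.newLeft i

/-- Lebesgue measure on `[0, 1)`. -/
noncomputable def lebesgueIco : Measure (Ico (0 : ℝ) 1) :=
  Measure.comap Subtype.val (volume : Measure ℝ)

/-- Partial rigidity of an invertible transformation `S` preserving the probability measure `ν`:
there are `δ > 0` and a strictly increasing sequence of times `m n` such that
`liminf ν (A ∩ S ^ (m n) A) ≥ δ * ν A` for all measurable sets `A`. -/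
def IsPartiallyRigid {Y : Type*} [MeasurableSpace Y] (S : Y → Y) (ν : Measure Y) : Prop :=
  ∃ δ : ℝ≥0, 0 < δ ∧ ∃ m : ℕ → ℕ, StrictMono m ∧ ∀ A : Set Y, MeasurableSet A →
    (δ : ℝ≥0∞) * ν A ≤ liminf (fun n => ν (A ∩ S^[m n] '' A)) atTop

/-! Let `T` be an ergodic IET with finite cut set `B`, and put K = |B| + 3. The first return map to
any nonempty subinterval has at most K branches, each moved rigidly until it returns. Induce on J =
[0, min ε 1). By ergodicity the return towers fill the space, so some branch P, of height h, carries
mass h|P| ≥ 1/K. Inducing again on P gives a branch Q, with return time m, such that |Q| ≥ |P|/K.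
The levels T^l Q, l < h, are disjoint; their union E has measure at least 1/K² and loses at most |Q|
≤ ε under `T`. On E the map T^m is within ε of the identity: for y in Q, both y and T^m y lie in P,
where T^l is a translation, so T^m displaces T^l y exactly as it displaces y
(`IsPiecewiseTranslation.exists_almost_invariant`).

Such sets give partial rigidity (`isPartiallyRigid_of_almost_invariant`). By the mean ergodic
theorem an almost invariant E meets each fixed set A in measure at least about ν(E)ν(A), and T^m
returns most of E ∩ A to A because it is close to the identity there. Aperiodicity forces m → ∞ as ε
→ 0. -/

/-! ### Mean ergodic theorem and almost invariant sets -/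

section Ergodic

variable {X : Type*} [MeasurableSpace X] {ν : Measure X} {T : X → X}

/-- Birkhoff averages of the indicator of `A` converge to `ν A`, uniformly when tested against
indicators of measurable sets. -/
theorem Ergodic.exists_average_measureReal_inter_preimage [IsProbabilityMeasure ν]
    (hT : Ergodic T ν) {A : Set X} (hA : MeasurableSet A) {ε : ℝ} (hε : 0 < ε) :
    ∃ N : ℕ, 0 < N ∧ ∀ E, MeasurableSet E →
      |(N : ℝ)⁻¹ * ∑ j ∈ Finset.range N, ν.real (E ∩ T^[j] ⁻¹' A) - ν.real E * ν.real A| ≤ ε := by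
  have hmp := hT.toMeasurePreserving
  -- Von Neumann's theorem for the Koopman operator: norm convergence of the averages makes the
  -- bound uniform in `E`, by Cauchy–Schwarz with ‖1_E‖ ≤ 1.
  let U : Lp ℝ 2 ν →L[ℝ] Lp ℝ 2 ν :=
    (Lp.compMeasurePreservingₗᵢ ℝ T hmp).toContinuousLinearMap
  have hU : ‖U‖ ≤ 1 := LinearIsometry.norm_toContinuousLinearMap_le _
  have hUapp : ∀ g, U g = Lp.compMeasurePreserving T hmp g := fun g => rfl
  let f : Lp ℝ 2 ν := indicatorConstLp 2 hA (measure_ne_top ν A) (1 : ℝ)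
  have hlim := U.tendsto_birkhoffAverage_orthogonalProjection hU f
  set g := (U.eqLocus (1 : Lp ℝ 2 ν →L[ℝ] Lp ℝ 2 ν)).orthogonalProjectionOnto f
  have hiter : ∀ j : ℕ, U^[j] f =
      indicatorConstLp 2 ((hmp.iterate j).measurable hA) (measure_ne_top ν _) (1 : ℝ) := by
    intro j
    have h1 : U^[j] f = Lp.compMeasurePreserving T^[j] (hmp.iterate j) f := by
      exact congrFun (Lp.compMeasurePreserving_iterate hmp j) f
    rw [h1]
    exact (Lp.indicatorConstLp_compMeasurePreserving hA (measure_ne_top ν _) 1 (hmp.iterate j)).symm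
  have hinner : ∀ {E : Set X} (hE : MeasurableSet E) (N : ℕ),
      inner ℝ (indicatorConstLp 2 hE (measure_ne_top ν E) (1 : ℝ))
        (birkhoffAverage ℝ U _root_.id N f) =
      (N : ℝ)⁻¹ * ∑ j ∈ Finset.range N, ν.real (E ∩ T^[j] ⁻¹' A) := by
    intro E hE N
    rw [birkhoffAverage, birkhoffSum, real_inner_smul_right, inner_sum]
    congr 1
    refine Finset.sum_congr rfl fun j _ => ?_
    rw [_root_.id, hiter, L2.real_inner_indicatorConstLp_one_indicatorConstLp_one]
  -- the limit is a constant
  obtain ⟨c, hc⟩ : ∃ c : ℝ, (g : Lp ℝ 2 ν) =ᵐ[ν] Function.const X c := by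
    have hfix : U (g : Lp ℝ 2 ν) = g := g.2
    refine hT.ae_eq_const_of_ae_eq_comp_ae (Lp.aestronglyMeasurable _) ?_
    have h2 := Lp.coeFn_compMeasurePreserving (g : Lp ℝ 2 ν) hmp
    rw [← hUapp, hfix] at h2
    exact h2.symm
  have hgE : ∀ {E : Set X} (hE : MeasurableSet E),
      inner ℝ (indicatorConstLp 2 hE (measure_ne_top ν E) (1 : ℝ)) (g : Lp ℝ 2 ν) =
        ν.real E * c := by
    intro E hE
    rw [L2.inner_indicatorConstLp_one]
    rw [setIntegral_congr_ae (g := fun _ => c) hE (hc.mono fun x hx _ => hx)]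
    simp
  have hcA : c = ν.real A := by
    have h3 : Tendsto (fun N : ℕ => inner ℝ
        (indicatorConstLp 2 MeasurableSet.univ (measure_ne_top ν univ) (1 : ℝ))
        (birkhoffAverage ℝ U _root_.id N f)) atTop
        (nhds (inner ℝ (indicatorConstLp 2 MeasurableSet.univ (measure_ne_top ν univ) (1 : ℝ))
          (g : Lp ℝ 2 ν))) := tendsto_const_nhds.inner hlim
    rw [hgE] at h3
    have h4 : Tendsto (fun N : ℕ => inner ℝ
        (indicatorConstLp 2 MeasurableSet.univ (measure_ne_top ν univ) (1 : ℝ))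
        (birkhoffAverage ℝ U _root_.id N f)) atTop (nhds (ν.real A)) := by
      refine tendsto_const_nhds.congr' ?_
      filter_upwards [eventually_gt_atTop 0] with N hN
      rw [hinner]
      have : ∀ j ∈ Finset.range N, ν.real (univ ∩ T^[j] ⁻¹' A) = ν.real A := by
        intro j _
        rw [univ_inter, measureReal_def,
          (hmp.iterate j).measure_preimage hA.nullMeasurableSet, measureReal_def]
      rw [Finset.sum_congr rfl this]
      have : (N : ℝ) ≠ 0 := by positivity
      simp [this]
    simpa using tendsto_nhds_unique h3 h4
  obtain ⟨N, hN, hN0⟩ := ((Metric.tendsto_nhds.1 hlim ε hε).and (eventually_gt_atTop 0)).exists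
  refine ⟨N, hN0, fun E hE => ?_⟩
  rw [← hinner hE N, ← hcA, ← hgE hE, ← inner_sub_right]
  refine (abs_real_inner_le_norm _ _).trans ?_
  rw [dist_eq_norm] at hN
  have h5 : ‖indicatorConstLp 2 hE (measure_ne_top ν E) (1 : ℝ)‖ ≤ 1 := by
    rw [norm_indicatorConstLp (by norm_num) (by norm_num)]
    simpa using Real.rpow_le_one measureReal_nonneg measureReal_le_one (by norm_num : (0:ℝ) ≤ 1/2)
  calc _ ≤ 1 * ε := mul_le_mul h5 hN.le (norm_nonneg _) zero_le_one
    _ = ε := one_mul ε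

theorem MeasureTheory.MeasurePreserving.measure_image_of_injective [StandardBorelSpace X]
    (hT : MeasurePreserving T ν ν) (hinj : Function.Injective T) {A : Set X}
    (hA : MeasurableSet A) : ν (T '' A) = ν A := by
  have h := hT.measure_preimage
    (hA.image_of_measurable_injOn hT.measurable hinj.injOn).nullMeasurableSet
  rw [preimage_image_eq _ hinj] at h
  exact h.symm

/-- A set which is almost invariant asymptotically fills every measurable set at least
proportionally. -/
theorem Ergodic.exists_almost_invariant_inter [IsProbabilityMeasure ν]
    (hT : Ergodic T ν) {A : Set X} (hA : MeasurableSet A) {ε : ℝ} (hε : 0 < ε) :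
    ∃ η > 0, ∀ E, MeasurableSet E →
      (∀ B, MeasurableSet B → ν.real (E ∩ T ⁻¹' B) - η ≤ ν.real (E ∩ B)) →
      ν.real E * ν.real A - ε ≤ ν.real (E ∩ A) := by
  obtain ⟨N, hN, hav⟩ := hT.exists_average_measureReal_inter_preimage hA (half_pos hε)
  have hN' : (0 : ℝ) < N := by exact_mod_cast hN
  -- Passing from `A` to its j-th preimage costs η at each of the j < N steps, hence at most ε / 2
  -- in all.
  refine ⟨ε / 2 / N, by positivity, fun E hE hinv => ?_⟩
  have hstep : ∀ j : ℕ, ν.real (E ∩ T^[j] ⁻¹' A) - j * (ε / 2 / N) ≤ ν.real (E ∩ A) := by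
    intro j
    induction j with
    | zero => simp
    | succ j ih =>
      have h := hinv (T^[j] ⁻¹' A) ((hT.toMeasurePreserving.iterate j).measurable hA)
      rw [← preimage_comp, ← Function.iterate_succ] at h
      push_cast
      linarith
  have hsum : (N : ℝ)⁻¹ * ∑ j ∈ Finset.range N, ν.real (E ∩ T^[j] ⁻¹' A) ≤
      ν.real (E ∩ A) + ε / 2 := by
    have : ∑ j ∈ Finset.range N, ν.real (E ∩ T^[j] ⁻¹' A) ≤
        ∑ j ∈ Finset.range N, (ν.real (E ∩ A) + ε / 2) := by
      refine Finset.sum_le_sum fun j hj => ?_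
      have h1 := hstep j
      have h2 : (j : ℝ) * (ε / 2 / N) ≤ N * (ε / 2 / N) := by
        gcongr; exact (Finset.mem_range.1 hj).le
      have h3 : (N : ℝ) * (ε / 2 / N) = ε / 2 := by field_simp
      linarith
    rw [Finset.sum_const, Finset.card_range, nsmul_eq_mul] at this
    rw [inv_mul_le_iff₀ hN']
    exact this
  have := (abs_le.1 (hav E hE)).1
  linarith

end Ergodic

/-! ### From almost invariant sets to partial rigidity -/

section Criterion

variable {X : Type*} [MetricSpace X] [MeasurableSpace X] [BorelSpace X] [SecondCountableTopology X]
  {ν : Measure X} [IsProbabilityMeasure ν] {T : X → X}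

/-- Sets of almost fixed points of `T^[m]` have small measure, uniformly for `1 ≤ m ≤ M`, when `T`
is aperiodic. -/
theorem exists_measureReal_dist_iterate_le_lt (hT : Measurable T)
    (hap : ∀ j, 0 < j → ν {x | T^[j] x = x} = 0) {δ : ℝ} (hδ : 0 < δ) (M : ℕ) :
    ∃ ε > 0, ∀ j, 0 < j → j ≤ M → ν.real {x | dist (T^[j] x) x ≤ ε} < δ := by
  have key : ∀ j, 0 < j → ∀ᶠ n : ℕ in atTop,
      ν.real {x | dist (T^[j] x) x ≤ 1 / ((n : ℝ) + 1)} < δ := by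
    intro j hj
    have hmeas : Measurable fun x => dist (T^[j] x) x := (hT.iterate j).dist measurable_id
    have h := tendsto_measure_iInter_atTop (μ := ν)
      (s := fun n : ℕ => {x | dist (T^[j] x) x ≤ 1 / ((n : ℝ) + 1)})
      (fun n => (hmeas measurableSet_Iic).nullMeasurableSet)
      (fun m n hmn x (hx : dist (T^[j] x) x ≤ 1 / ((n : ℝ) + 1)) =>
        hx.trans (Nat.one_div_le_one_div hmn))
      ⟨0, measure_ne_top ν _⟩
    have h0 : ⋂ n : ℕ, {x | dist (T^[j] x) x ≤ 1 / ((n : ℝ) + 1)} = {x | T^[j] x = x} := by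
      ext x
      simp only [mem_iInter, mem_ofPred_eq]
      constructor
      · intro hx
        have := ge_of_tendsto' tendsto_one_div_add_atTop_nhds_zero_nat hx
        exact dist_le_zero.1 this
      · intro hx n
        rw [hx, dist_self]; positivity
    rw [h0, hap j hj] at h
    have h' := (ENNReal.tendsto_toReal (by simp : (0 : ℝ≥0∞) ≠ ⊤)).comp h
    exact h'.eventually_lt_const (by simpa using hδ)
  have hall : ∀ᶠ n : ℕ in atTop, ∀ j ∈ Finset.Icc 1 M,
      ν.real {x | dist (T^[j] x) x ≤ 1 / ((n : ℝ) + 1)} < δ :=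
    (Finset.eventually_all _).2 fun j hj => key j (Finset.mem_Icc.1 hj).1
  obtain ⟨n, hn⟩ := hall.exists
  exact ⟨1 / ((n : ℝ) + 1), by positivity, fun j h1 h2 => hn j (Finset.mem_Icc.2 ⟨h1, h2⟩)⟩

/-- An aperiodic ergodic injective transformation is partially rigid when some iterates are close
to the identity on almost invariant sets of measure bounded from below. -/
theorem isPartiallyRigid_of_almost_invariant [StandardBorelSpace X]
    (hT : Ergodic T ν) (hinj : Function.Injective T)
    (hap : ∀ j, 0 < j → ν {x | T^[j] x = x} = 0) {δ : ℝ} (hδ : 0 < δ)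
    (h : ∀ ε > 0, ∃ m, 0 < m ∧ ∃ E, MeasurableSet E ∧ δ ≤ ν.real E ∧
      (∀ B, MeasurableSet B → ν.real (E ∩ T ⁻¹' B) - ε ≤ ν.real (E ∩ B)) ∧
      ∀ x ∈ E, dist (T^[m] x) x ≤ ε) :
    IsPartiallyRigid T ν := by
  have hmp := hT.toMeasurePreserving
  have hlarge : ∀ ε > 0, ∀ M, ∃ m, M < m ∧ ∃ E, MeasurableSet E ∧ δ ≤ ν.real E ∧
      (∀ B, MeasurableSet B → ν.real (E ∩ T ⁻¹' B) - ε ≤ ν.real (E ∩ B)) ∧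
      ∀ x ∈ E, dist (T^[m] x) x ≤ ε := by
    intro ε hε M
    obtain ⟨ε', hε', hM⟩ := exists_measureReal_dist_iterate_le_lt hmp.measurable hap hδ M
    -- With m ≤ M, the set `E` would lie in a set of almost fixed points of measure less than δ.
    obtain ⟨m, hm, E, hE, hEδ, hEinv, hEd⟩ := h (min ε ε') (lt_min hε hε')
    refine ⟨m, ?_, E, hE, hEδ, fun B hB => ?_, fun x hx => (hEd x hx).trans (min_le_left _ _)⟩
    · by_contra hmM
      have h1 := hM m hm (not_lt.1 hmM)
      have h2 : ν.real E ≤ ν.real {x | dist (T^[m] x) x ≤ ε'} :=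
        measureReal_mono fun x hx => (hEd x hx).trans (min_le_right _ _)
      linarith
    · have := hEinv B hB
      have := min_le_left ε ε'
      linarith
  -- a sequence of times
  have hpos : ∀ n : ℕ, (0 : ℝ) < 1 / ((n : ℝ) + 1) := fun n => by positivity
  choose next hnext E hE hEδ hEinv hEd using fun (n : ℕ) (M : ℕ) =>
    hlarge (1 / ((n : ℝ) + 1)) (hpos n) M
  -- `prev (n + 1)` is the n-th chosen time, so each new time exceeds the preceding one.
  let prev : ℕ → ℕ := fun n => Nat.rec 0 (fun k M => next k M) n
  refine ⟨δ.toNNReal, Real.toNNReal_pos.2 hδ, fun n => next n (prev n), strictMono_nat_of_lt_succ fun n => ?_, ?_⟩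
  · exact hnext (n + 1) (prev (n + 1))
  intro A hA
  -- rewrite the intersections through preimages
  have himg : ∀ m, ν (A ∩ T^[m] '' A) = ν (A ∩ T^[m] ⁻¹' A) := by
    intro m
    have hm := hmp.iterate m
    have hAm : MeasurableSet (T^[m] '' A) :=
      hA.image_of_measurable_injOn hm.measurable (hinj.iterate m).injOn
    rw [← hm.measure_preimage (hA.inter hAm).nullMeasurableSet, preimage_inter,
      preimage_image_eq _ (hinj.iterate m), inter_comm]
  simp only [himg]
  have hreal : ∀ η > 0, ∀ᶠ n in atTop,
      δ * ν.real A - η ≤ ν.real (A ∩ T^[next n (prev n)] ⁻¹' A) := by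
    intro η hη
    have hδ1 : δ ≤ 1 := (hEδ 0 0).trans measureReal_le_one
    -- For closed `K` the thickenings shrink to `K` in measure, so a small displacement rarely
    -- leaves `K`. The three losses of η / 3 come from `A \ K`, the thickening, and the filling
    -- estimate.
    obtain ⟨K, hKA, hK, hKlt⟩ := hA.exists_isClosed_sdiff_lt (measure_ne_top ν A)
      (ε := ENNReal.ofReal (η / 3)) (by simpa using hη)
    have hKreal : ν.real A - η / 3 ≤ ν.real K := by
      have h1 : ν.real (A \ K) ≤ η / 3 :=
        ENNReal.toReal_le_of_le_ofReal (by positivity) hKlt.le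
      rw [measureReal_sdiff hKA hK.measurableSet] at h1
      linarith
    have hthick : ∀ᶠ r in nhds (0 : ℝ), ν.real (Metric.cthickening r K) < ν.real K + η / 3 := by
      have h1 := tendsto_measure_cthickening_of_isClosed (μ := ν) (s := K)
        ⟨1, one_pos, measure_ne_top ν _⟩ hK
      have h2 := (ENNReal.tendsto_toReal (measure_ne_top ν K)).comp h1
      exact h2.eventually_lt_const (by simp only [measureReal_def]; linarith)
    obtain ⟨η', hη', hfill⟩ := hT.exists_almost_invariant_inter hK.measurableSet
      (show 0 < η / 3 by positivity)
    have hlim := tendsto_one_div_add_atTop_nhds_zero_nat (𝕜 := ℝ)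
    filter_upwards [hlim.eventually hthick, hlim.eventually_lt_const hη'] with n hn1 hn2
    set m := next n (prev n)
    set F := E n (prev n)
    have hF := hfill F (hE _ _) fun B hB => by
      have := hEinv n (prev n) B hB
      linarith
    set C := Metric.cthickening (1 / ((n : ℝ) + 1)) K
    have hC : MeasurableSet C := Metric.isClosed_cthickening.measurableSet
    have hKC : K ⊆ C := Metric.self_subset_cthickening K
    have hsub : F ∩ K ⊆ (A ∩ T^[m] ⁻¹' A) ∪ T^[m] ⁻¹' (C \ K) := by
      rintro x ⟨hxF, hxK⟩
      by_cases hxm : T^[m] x ∈ K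
      · exact Or.inl ⟨hKA hxK, hKA hxm⟩
      · exact Or.inr ⟨Metric.mem_cthickening_of_dist_le _ x _ _ hxK (hEd n (prev n) x hxF), hxm⟩
    have h1 : ν.real (F ∩ K) ≤ ν.real (A ∩ T^[m] ⁻¹' A) + ν.real (C \ K) := by
      refine (measureReal_mono hsub).trans ((measureReal_union_le _ _).trans_eq ?_)
      congr 1
      simp only [measureReal_def]
      rw [(hmp.iterate m).measure_preimage (hC.diff hK.measurableSet).nullMeasurableSet]
    rw [measureReal_sdiff hKC hK.measurableSet] at h1
    have h2 : δ * ν.real K ≤ ν.real F * ν.real K :=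
      mul_le_mul_of_nonneg_right (hEδ _ _) measureReal_nonneg
    have h3 : δ * (ν.real A - ν.real K) ≤ 1 * (ν.real A - ν.real K) :=
      mul_le_mul_of_nonneg_right hδ1 (sub_nonneg.2 (measureReal_mono hKA))
    nlinarith
  refine le_of_forall_lt fun c hc => ?_
  change c < ENNReal.ofReal δ * ν A at hc
  rw [← ofReal_measureReal (μ := ν) (s := A),
    ← ENNReal.ofReal_mul hδ.le] at hc
  obtain ⟨c', hcc', hc'⟩ := exists_between hc
  have hc'top : c' ≠ ⊤ := (hc'.trans ENNReal.ofReal_lt_top).ne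
  have hc'r : c'.toReal < δ * ν.real A :=
    (ENNReal.lt_ofReal_iff_toReal_lt hc'top).1 hc'
  refine lt_of_lt_of_le hcc' (le_liminf_of_le (by isBoundedDefault) ?_)
  filter_upwards [hreal (δ * ν.real A - c'.toReal) (by linarith)] with n hn
  rw [sub_sub_cancel] at hn
  exact (ENNReal.le_ofReal_iff_toReal_le hc'top measureReal_nonneg).2 hn |>.trans_eq
    (ofReal_measureReal)

end Criterion

/-! ### Counting cut points and cutting intervals -/

/-- The points of `J` whose orbit meets `S` before returning to `J` are at most as many as the
points of `S`. -/
theorem encard_setOf_hits_before_return_le {X : Type*} {T : X → X} (hinj : Function.Injective T)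
    (J S : Set X) :
    {y | y ∈ J ∧ ∃ j, (∀ i, 0 < i → i ≤ j → T^[i] y ∉ J) ∧ T^[j] y ∈ S}.encard ≤ S.encard := by
  classical
  choose! j hj using fun (y : X)
    (hy : y ∈ {y | y ∈ J ∧ ∃ j, (∀ i, 0 < i → i ≤ j → T^[i] y ∉ J) ∧ T^[j] y ∈ S}) => hy.2
  -- Two points with the same hit lie on one orbit; if distinct, the later hitter would meet the
  -- other, hence `J`, too early.
  have aux : ∀ y z, y ∈ J → (∀ i, 0 < i → i ≤ j z → T^[i] z ∉ J) → j y ≤ j z →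
      T^[j y] y = T^[j z] z → y = z := by
    intro y z hy hz hle heq
    obtain ⟨k, hk⟩ := Nat.exists_eq_add_of_le hle
    rw [hk, Function.iterate_add_apply] at heq
    have h := hinj.iterate _ heq
    rcases Nat.eq_zero_or_pos k with rfl | hk0
    · simpa using h
    · exact absurd (h ▸ hy) (hz k hk0 (by omega))
  refine encard_le_encard_of_injOn (f := fun y => T^[j y] y) (fun y hy => (hj y hy).2) ?_
  intro y hy z hz heq
  rcases le_total (j y) (j z) with h | h
  · exact aux y z hy.1 (hj z hz).1 h heq
  · exact (aux z y hz.1 (hj y hy).1 h heq.symm).symm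

/-- A finite set cuts a half-open interval into half-open intervals. -/
theorem exists_partition_Ico (F : Finset ℝ) (a b : ℝ) :
    ∃ (s : Finset ℝ) (next : ℝ → ℝ), s.card ≤ F.card + 1 ∧
      (∀ p ∈ s, a ≤ p ∧ p < next p ∧ next p ≤ b ∧ ∀ q ∈ F, p < q → next p ≤ q) ∧
      ∀ x ∈ Ico a b, ∃ p ∈ s, x ∈ Ico p (next p) := by
  classical
  have hnext : ∀ p, p < b → ∃ c, p < c ∧ c ≤ b ∧ (c = b ∨ c ∈ F) ∧ ∀ q ∈ F, p < q → c ≤ q := by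
    intro p hp
    let G := (insert b F).filter (p < ·)
    have hG : G.Nonempty := ⟨b, by simp [G, hp]⟩
    have h1 := G.min'_mem hG
    have h2 : ∀ q ∈ G, G.min' hG ≤ q := fun q hq => G.min'_le q hq
    refine ⟨G.min' hG, ?_, h2 b (by simp [G, hp]), ?_, fun q hq hpq => h2 q (by simp [G, hq, hpq])⟩
    · exact (Finset.mem_filter.1 h1).2
    · simpa using (Finset.mem_filter.1 h1).1
  choose! next h1 h2 h3 h4 using hnext
  refine ⟨(insert a F).filter (fun p => a ≤ p ∧ p < b), next, ?_, ?_, ?_⟩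
  · exact (Finset.card_filter_le _ _).trans (Finset.card_insert_le _ _)
  · intro p hp
    obtain ⟨-, hap, hpb⟩ := Finset.mem_filter.1 hp
    exact ⟨hap, h1 p hpb, h2 p hpb, h4 p hpb⟩
  · intro x hx
    let G := (insert a F).filter (fun p => a ≤ p ∧ p ≤ x)
    have hG : G.Nonempty := ⟨a, by simp [G, hx.1]⟩
    have h5 := G.max'_mem hG
    have h6 : ∀ q ∈ G, q ≤ G.max' hG := fun q hq => G.le_max' q hq
    set p := G.max' hG
    obtain ⟨hpF, hap, hpx⟩ := Finset.mem_filter.1 h5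
    have hpb : p < b := hpx.trans_lt hx.2
    refine ⟨p, Finset.mem_filter.2 ⟨hpF, hap, hpb⟩, hpx, ?_⟩
    by_contra hcon
    rw [not_lt] at hcon
    rcases h3 p hpb with h7 | h7
    · rw [h7] at hcon; exact absurd hx.2 (not_lt.2 hcon)
    · have h8 := h6 (next p) (Finset.mem_filter.2
        ⟨Finset.mem_insert_of_mem h7, hap.trans (h1 p hpb).le, hcon⟩)
      exact absurd (h1 p hpb) (not_lt.2 h8)

/-! ### Segments, Lebesgue measure and piecewise translations -/

/-- The points of `[0, 1)` that lie in `[a, b)`. -/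
def seg (a b : ℝ) : Set (Ico (0 : ℝ) 1) := Subtype.val ⁻¹' Ico a b

theorem measurableSet_seg (a b : ℝ) : MeasurableSet (seg a b) :=
  measurable_subtype_coe measurableSet_Ico

theorem lebesgueIco_seg {a b : ℝ} (ha : 0 ≤ a) (hb : b ≤ 1) :
    lebesgueIco (seg a b) = ENNReal.ofReal (b - a) := by
  rw [lebesgueIco, comap_subtype_coe_apply measurableSet_Ico, seg, Subtype.image_preimage_coe,
    inter_eq_right.2 (Ico_subset_Ico ha hb), Real.volume_Ico]

theorem lebesgueIco_real_seg {a b : ℝ} (ha : 0 ≤ a) (hab : a ≤ b) (hb : b ≤ 1) :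
    lebesgueIco.real (seg a b) = b - a := by
  rw [measureReal_def, lebesgueIco_seg ha hb, ENNReal.toReal_ofReal (sub_nonneg.2 hab)]

instance standardBorelSpace_Ico_zero_one : StandardBorelSpace (Ico (0 : ℝ) 1) :=
  measurableSet_Ico.standardBorel

instance isProbabilityMeasure_lebesgueIco : IsProbabilityMeasure lebesgueIco := by
  constructor
  have h : (univ : Set (Ico (0 : ℝ) 1)) = seg 0 1 := by
    exact (eq_univ_of_forall fun x => x.2).symm
  rw [h, lebesgueIco_seg le_rfl le_rfl]; simp

/-- `T` is a translation between any two consecutive points of `B`. -/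
def IsPiecewiseTranslation (T : Ico (0 : ℝ) 1 → Ico (0 : ℝ) 1) (B : Finset ℝ) : Prop :=
  ∀ x y : Ico (0 : ℝ) 1, (x : ℝ) < y → (∀ β ∈ B, (x : ℝ) < β → (y : ℝ) < β) →
    (T y : ℝ) - T x = y - x

/-- All points of `[p, q)` return to `J` for the first time at time `r`, and are moved rigidly
up to that time. -/
structure IsReturnTower (T : Ico (0 : ℝ) 1 → Ico (0 : ℝ) 1) (J : Set (Ico (0 : ℝ) 1)) (p q : ℝ)
    (r : ℕ) : Prop where
  pos : 0 < r
  return_mem : ∀ x ∈ seg p q, T^[r] x ∈ J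
  notMem : ∀ x ∈ seg p q, ∀ l, 0 < l → l < r → T^[l] x ∉ J
  translation : ∀ l ≤ r, ∀ x ∈ seg p q, ∀ y ∈ seg p q, (T^[l] y : ℝ) - T^[l] x = y - x

/-- Intermediate values for a translation: a cut value crossed by the image has a preimage in the
segment. The strict `x < z` matters, since only the left endpoint of a piece may be a cut point. -/
theorem seg_convex_iterate {T : Ico (0 : ℝ) 1 → Ico (0 : ℝ) 1} {p q : ℝ} {l : ℕ}
    (h : ∀ x ∈ seg p q, ∀ y ∈ seg p q, (T^[l] y : ℝ) - T^[l] x = y - x)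
    {x y : Ico (0 : ℝ) 1} (hx : x ∈ seg p q) (hy : y ∈ seg p q) {c : ℝ}
    (hc1 : (T^[l] x : ℝ) < c) (hc2 : c ≤ T^[l] y) :
    ∃ z ∈ seg p q, x < z ∧ z ≤ y ∧ (T^[l] z : ℝ) = c := by
  have hxy := h x hx y hy
  have hz0 : 0 ≤ (x : ℝ) + (c - T^[l] x) := by linarith [x.2.1]
  have hzy : (x : ℝ) + (c - T^[l] x) ≤ y := by linarith
  let z : Ico (0 : ℝ) 1 := ⟨x + (c - T^[l] x), hz0, hzy.trans_lt y.2.2⟩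
  have hxz : (x : ℝ) < z := by change (x : ℝ) < x + (c - T^[l] x); linarith
  have hz : z ∈ seg p q := ⟨hx.1.trans hxz.le, hzy.trans_lt hy.2⟩
  refine ⟨z, hz, hxz, hzy, ?_⟩
  have h1 := h x hx z hz
  have h2 : (z : ℝ) = x + (c - T^[l] x) := rfl
  linarith

/-! ### First return maps of piecewise translations -/

section Return

variable {T : Ico (0 : ℝ) 1 → Ico (0 : ℝ) 1} {B : Finset ℝ}

/-- The first return map to a subinterval has few branches. -/
theorem IsPiecewiseTranslation.exists_return_partition (hT : IsPiecewiseTranslation T B)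
    (hinj : Function.Injective T) (hmp : MeasurePreserving T lebesgueIco lebesgueIco)
    {a b : ℝ} (ha : 0 ≤ a) (hb : b ≤ 1) :
    ∃ (s : Finset ℝ) (next : ℝ → ℝ) (r : ℝ → ℕ), s.card ≤ B.card + 3 ∧
      (∀ p ∈ s, a ≤ p ∧ p < next p ∧ next p ≤ b ∧ IsReturnTower T (seg a b) p (next p) (r p)) ∧
      ∀ x ∈ seg a b, ∃ p ∈ s, x ∈ seg p (next p) := by
  classical
  set J := seg a b with hJ
  -- Hitting `B` can break the translation; landing on `a` or `b` at the next step can split the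
  -- return. These |B| + 2 possible hits yield at most |B| + 3 pieces.
  let S : Set (Ico (0 : ℝ) 1) := Subtype.val ⁻¹' (B : Set ℝ) ∪ (fun x => (T x : ℝ)) ⁻¹' {a, b}
  have hS : S.encard ≤ B.card + 2 := by
    refine (encard_union_le _ _).trans (add_le_add ?_ ?_)
    · rw [← encard_coe_eq_coe_finsetCard]
      exact encard_le_encard_of_injOn (f := Subtype.val) (fun x hx => hx) Subtype.val_injective.injOn
    · refine (encard_le_encard_of_injOn (t := {a, b}) (f := fun x => (T x : ℝ)) (fun x hx => hx)
        (Subtype.val_injective.comp hinj).injOn).trans (encard_insert_le _ _ |>.trans ?_)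
      rw [encard_singleton]; norm_num
  set F := {y | y ∈ J ∧ ∃ j, (∀ i, 0 < i → i ≤ j → T^[i] y ∉ J) ∧ T^[j] y ∈ S} with hF
  have hFcard : F.encard ≤ B.card + 2 := (encard_setOf_hits_before_return_le hinj J S).trans hS
  have hFfin : F.Finite := finite_of_encard_le_coe (k := B.card + 2) (by exact_mod_cast hFcard)
  let F' : Finset ℝ := hFfin.toFinset.image Subtype.val
  have hF'card : F'.card ≤ B.card + 2 := by
    refine Finset.card_image_le.trans ?_
    rw [hFfin.encard_eq_coe_toFinset_card] at hFcard
    exact_mod_cast hFcard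
  obtain ⟨s, next, hs, hnext, hcov⟩ := exists_partition_Ico F' a b
  -- points of a piece other than its left endpoint are not cut points
  have hcut : ∀ p ∈ s, ∀ x ∈ seg p (next p), ∀ y ∈ seg p (next p), x < y → y ∉ F := by
    intro p hp x hx y hy hxy hyF
    exact absurd hy.2 (not_lt.2 ((hnext p hp).2.2.2 y
      (Finset.mem_image_of_mem _ (hFfin.mem_toFinset.2 hyF)) (hx.1.trans_lt hxy)))
  have hsub : ∀ p ∈ s, seg p (next p) ⊆ J := fun p hp x hx =>
    ⟨(hnext p hp).1.trans hx.1, hx.2.trans_le (hnext p hp).2.2.1⟩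
  have hmove : ∀ p ∈ s, ∀ l, (∀ x ∈ seg p (next p), ∀ i, 0 < i → i < l → T^[i] x ∉ J) →
      ∀ x ∈ seg p (next p), ∀ y ∈ seg p (next p), (T^[l] y : ℝ) - T^[l] x = y - x := by
    intro p hp l
    induction l with
    | zero => exact fun _ x _ y _ => rfl
    | succ l ih =>
      intro hno
      have htr := ih fun x hx i h1 h2 => hno x hx i h1 (by omega)
      have hlt : ∀ x ∈ seg p (next p), ∀ y ∈ seg p (next p), x < y →
          (T^[l + 1] y : ℝ) - T^[l + 1] x = y - x := by
        intro x hx y hy hxy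
        rw [Function.iterate_succ_apply', Function.iterate_succ_apply', hT, htr x hx y hy]
        · have := htr x hx y hy
          have hxy' : (x : ℝ) < y := hxy
          linarith
        · intro β hβ hxβ
          by_contra hyβ
          obtain ⟨z, hz, hxz, -, hzβ⟩ := seg_convex_iterate htr hx hy hxβ (not_lt.1 hyβ)
          exact hcut p hp x hx z hz hxz ⟨hsub p hp hz, l,
            fun i h1 h2 => hno z hz i h1 (by omega), Or.inl (by
            rw [mem_preimage, hzβ]; exact hβ)⟩
      intro x hx y hy
      rcases lt_trichotomy x y with h | rfl | h
      · exact hlt x hx y hy h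
      · simp
      · linarith [hlt y hy x hx h]
  have htower : ∀ p ∈ s, ∃ r, IsReturnTower T J p (next p) r := by
    intro p hp
    obtain ⟨hap, hpn, hnb, -⟩ := hnext p hp
    -- The height is the first time any point of the piece enters `J`. Then the whole piece enters:
    -- otherwise its image would cross `a` or `b`, producing an interior cut point.
    have hex : ∃ r, 0 < r ∧ ∃ x ∈ seg p (next p), T^[r] x ∈ J := by
      obtain ⟨x, hx, m, hm, hmx⟩ := hmp.conservative.exists_mem_iterate_mem
        (measurableSet_seg p (next p)).nullMeasurableSet (by
          rw [lebesgueIco_seg (ha.trans hap) (hnb.trans hb)]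
          simpa using hpn)
      exact ⟨m, Nat.pos_of_ne_zero hm, x, hx, hsub p hp hmx⟩
    obtain ⟨hr, x, hx, hxJ⟩ := Nat.find_spec hex
    have hmin : ∀ y ∈ seg p (next p), ∀ l, 0 < l → l < Nat.find hex → T^[l] y ∉ J :=
      fun y hy l hl hlr hyJ => Nat.find_min hex hlr ⟨hl, y, hy, hyJ⟩
    set r := Nat.find hex
    obtain ⟨k, hk⟩ : ∃ k, r = k + 1 := ⟨r - 1, by omega⟩
    have htrans : ∀ l ≤ r, ∀ x ∈ seg p (next p), ∀ y ∈ seg p (next p),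
        (T^[l] y : ℝ) - T^[l] x = y - x := by
      exact fun l hl => hmove p hp l fun y hy i hi hil => hmin y hy i hi (by omega)
    have hbad : ∀ y ∈ seg p (next p), ∀ z ∈ seg p (next p), y < z → ∀ c ∈ ({a, b} : Set ℝ),
        (T^[r] z : ℝ) = c → False := by
      intro y hy z hz hyz c hc hzc
      refine hcut p hp y hy z hz hyz ⟨hsub p hp hz, k, fun i hi hik =>
        hmin z hz i hi (by omega), Or.inr ?_⟩
      rw [mem_preimage, ← Function.iterate_succ_apply' T k z, Nat.succ_eq_add_one, ← hk, hzc]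
      exact hc
    refine ⟨r, hr, fun y hy => ?_, hmin, htrans⟩
    have hle := htrans r le_rfl
    by_contra hyJ
    have hyJ' : (T^[r] y : ℝ) < a ∨ b ≤ T^[r] y := by
      by_contra hcon
      rw [not_or, not_lt, not_le] at hcon
      exact hyJ hcon
    rcases hyJ' with h | h
    · obtain ⟨z, hz, hyz, -, hzc⟩ := seg_convex_iterate hle hy hx h hxJ.1
      exact hbad y hy z hz hyz a (by simp) hzc
    · obtain ⟨z, hz, hxz, -, hzc⟩ := seg_convex_iterate hle hx hy hxJ.2 h
      exact hbad x hx z hz hxz b (by simp) hzc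
  choose! r hr using htower
  exact ⟨s, next, r, by omega, fun p hp => ⟨(hnext p hp).1, (hnext p hp).2.1, (hnext p hp).2.2.1,
    hr p hp⟩, fun x hx => hcov x hx⟩

end Return

/-! ### Rokhlin-type towers and aperiodicity -/

section Towers

variable {T : Ico (0 : ℝ) 1 → Ico (0 : ℝ) 1} {B : Finset ℝ}

theorem measurableSet_iterate_image (hT : Measurable T) (hinj : Function.Injective T)
    {A : Set (Ico (0 : ℝ) 1)} (hA : MeasurableSet A) (l : ℕ) : MeasurableSet (T^[l] '' A) :=
  hA.image_of_measurable_injOn (hT.iterate l) (hinj.iterate l).injOn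

theorem measureReal_iterate_image_seg (hmp : MeasurePreserving T lebesgueIco lebesgueIco)
    (hinj : Function.Injective T) {p q : ℝ} (hp : 0 ≤ p) (hpq : p ≤ q) (hq : q ≤ 1) (l : ℕ) :
    lebesgueIco.real (T^[l] '' seg p q) = q - p := by
  rw [← lebesgueIco_real_seg hp hpq hq, measureReal_def, measureReal_def,
    (hmp.iterate l).measure_image_of_injective (hinj.iterate l) (measurableSet_seg p q)]

/-- The return towers over an interval fill the whole space. -/
theorem one_le_sum_tower (hT : Ergodic T lebesgueIco) (hinj : Function.Injective T)
    {a b : ℝ} (ha : 0 ≤ a) (hab : a < b) (hb : b ≤ 1) {s : Finset ℝ} {next : ℝ → ℝ} {r : ℝ → ℕ}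
    (hs : ∀ p ∈ s, a ≤ p ∧ p < next p ∧ next p ≤ b ∧ IsReturnTower T (seg a b) p (next p) (r p))
    (hcov : ∀ x ∈ seg a b, ∃ p ∈ s, x ∈ seg p (next p)) :
    1 ≤ ∑ p ∈ s, (r p : ℝ) * (next p - p) := by
  have hmp := hT.toMeasurePreserving
  set W : Set (Ico (0 : ℝ) 1) := ⋃ j : ℕ, T^[j] '' seg a b with hW
  have hWm : MeasurableSet W := MeasurableSet.iUnion fun j =>
    measurableSet_iterate_image hmp.measurable hinj (measurableSet_seg a b) j
  have hTW : T '' W ⊆ W := by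
    rintro _ ⟨x, hx, rfl⟩
    obtain ⟨j, y, hy, rfl⟩ := mem_iUnion.1 hx
    exact mem_iUnion.2 ⟨j + 1, y, hy, Function.iterate_succ_apply' T j y⟩
  have hJW : seg a b ⊆ W := fun x hx => mem_iUnion.2 ⟨0, x, hx, rfl⟩
  have hJpos : 0 < lebesgueIco.real (seg a b) := by
    rw [lebesgueIco_real_seg ha hab.le hb]; linarith
  -- The forward orbit of `J` is forward invariant and has positive measure.
  have hW1 : lebesgueIco.real W = 1 := by
    rcases hT.ae_empty_or_univ_of_image_ae_le hWm.nullMeasurableSet hTW.eventuallyLE with h | h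
    · have h1 := measureReal_mono (μ := lebesgueIco) hJW
      rw [measureReal_congr h, measureReal_empty] at h1
      linarith
    · rw [measureReal_congr h, probReal_univ]
  have hsub : W ⊆ ⋃ p ∈ s, ⋃ l ∈ Finset.range (r p), T^[l] '' seg p (next p) := by
    have key : ∀ j : ℕ, ∀ y ∈ seg a b,
        T^[j] y ∈ ⋃ p ∈ s, ⋃ l ∈ Finset.range (r p), T^[l] '' seg p (next p) := by
      intro j
      induction j using Nat.strong_induction_on with
      | _ j ih =>
        intro y hy
        obtain ⟨p, hp, hyp⟩ := hcov y hy
        have htow := (hs p hp).2.2.2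
        rcases lt_or_ge j (r p) with h | h
        · exact mem_biUnion hp (mem_biUnion (Finset.mem_coe.2 (Finset.mem_range.2 h)) ⟨y, hyp, rfl⟩)
        · have h1 := ih (j - r p) (by have := htow.pos; omega) _ (htow.return_mem y hyp)
          rwa [← Function.iterate_add_apply, Nat.sub_add_cancel h] at h1
    intro x hx
    obtain ⟨j, y, hy, rfl⟩ := mem_iUnion.1 hx
    exact key j y hy
  rw [← hW1]
  refine (measureReal_mono hsub (measure_ne_top _ _)).trans ((measureReal_biUnion_finset_le _ _).trans ?_)
  refine Finset.sum_le_sum fun p hp => (measureReal_biUnion_finset_le _ _).trans_eq ?_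
  obtain ⟨h1, h2, h3, -⟩ := hs p hp
  rw [Finset.sum_congr rfl fun l _ => measureReal_iterate_image_seg hmp hinj (ha.trans h1) h2.le
    (h3.trans hb) l, Finset.sum_const, Finset.card_range, nsmul_eq_mul]

/-- Ergodic piecewise translations are close to the identity at some time on an almost invariant
set of definite measure. -/
theorem IsPiecewiseTranslation.exists_almost_invariant (hB : IsPiecewiseTranslation T B)
    (hT : Ergodic T lebesgueIco) (hinj : Function.Injective T) {ε : ℝ} (hε : 0 < ε) :
    ∃ m, 0 < m ∧ ∃ E, MeasurableSet E ∧ (1 / ((B.card : ℝ) + 3) ^ 2) ≤ lebesgueIco.real E ∧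
      (∀ A, MeasurableSet A →
        lebesgueIco.real (E ∩ T ⁻¹' A) - ε ≤ lebesgueIco.real (E ∩ A)) ∧
      ∀ x ∈ E, dist (T^[m] x) x ≤ ε := by
  have hmp := hT.toMeasurePreserving
  set K : ℝ := (B.card : ℝ) + 3 with hK
  have hKpos : 0 < K := by positivity
  have pigeon : ∀ (s : Finset ℝ) (w : ℝ → ℝ) (c : ℝ), s.card ≤ B.card + 3 → 0 < c →
      c ≤ ∑ p ∈ s, w p → ∃ p ∈ s, c / K ≤ w p := by
    intro s w c hs hc hsum
    by_contra! hcon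
    have hne : s.Nonempty := by
      rw [Finset.nonempty_iff_ne_empty]
      rintro rfl
      rw [Finset.sum_empty] at hsum; linarith
    have h1 := Finset.sum_lt_sum_of_nonempty hne hcon
    rw [Finset.sum_const, nsmul_eq_mul] at h1
    have h2 : (s.card : ℝ) ≤ K := by rw [hK]; exact_mod_cast hs
    have h3 : (s.card : ℝ) * (c / K) ≤ K * (c / K) := by gcongr
    rw [mul_div_cancel₀ _ hKpos.ne'] at h3
    linarith
  -- The base lies in [0, ε), which bounds both the final displacement and the mass lost at the top
  -- level.
  have hb0 : 0 < min ε 1 := lt_min hε one_pos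
  obtain ⟨s, next, r, hs, htow, hcov⟩ :=
    hB.exists_return_partition hinj hmp le_rfl (min_le_right ε 1)
  obtain ⟨p, hp, hpw⟩ := pigeon s _ 1 hs one_pos
    (one_le_sum_tower hT hinj le_rfl hb0 (min_le_right ε 1) htow hcov)
  obtain ⟨hp0, hpn, hnb, hP⟩ := htow p hp
  set q := next p
  set h := r p
  have hq1 : q ≤ 1 := hnb.trans (min_le_right _ _)
  have hqε : q - p ≤ ε := by have := hnb.trans (min_le_left ε 1); linarith
  -- Second induction, on the base `[p, q)` itself: returning to this base, rather than only to the
  -- first interval, lets T^l act as one translation on a point and its return.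
  obtain ⟨s', next', r', hs', htow', hcov'⟩ := hB.exists_return_partition hinj hmp hp0 hq1
  have hlen : q - p ≤ ∑ p' ∈ s', (next' p' - p') := by
    rw [← lebesgueIco_real_seg hp0 hpn.le hq1]
    have hsub : seg p q ⊆ ⋃ p' ∈ s', seg p' (next' p') := by
      intro x hx
      obtain ⟨p', hp', hx'⟩ := hcov' x hx
      exact mem_biUnion hp' hx'
    refine (measureReal_mono hsub (measure_ne_top _ _)).trans ((measureReal_biUnion_finset_le _ _).trans_eq ?_)
    refine Finset.sum_congr rfl fun p' hp' => ?_
    obtain ⟨h1, h2, h3, -⟩ := htow' p' hp'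
    exact lebesgueIco_real_seg (hp0.trans h1) h2.le (h3.trans hq1)
  obtain ⟨p', hp', hpw'⟩ := pigeon s' _ (q - p) hs' (by linarith) hlen
  obtain ⟨hpp', hpn', hnq', hQ⟩ := htow' p' hp'
  set q' := next' p'
  set m := r' p'
  have hQP : seg p' q' ⊆ seg p q := fun x hx => ⟨hpp'.trans hx.1, hx.2.trans_le hnq'⟩
  have hPJ : seg p q ⊆ seg 0 (min ε 1) := fun x hx => ⟨hp0.trans hx.1, hx.2.trans_le hnb⟩
  have hQm : ∀ l, lebesgueIco.real (T^[l] '' seg p' q') = q' - p' :=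
    measureReal_iterate_image_seg hmp hinj (hp0.trans hpp') hpn'.le (hnq'.trans hq1)
  have hQmeas : ∀ l, MeasurableSet (T^[l] '' seg p' q') :=
    measurableSet_iterate_image hmp.measurable hinj (measurableSet_seg p' q')
  set E : Set (Ico (0 : ℝ) 1) := ⋃ l ∈ Finset.range h, T^[l] '' seg p' q' with hE
  have hEmeas : MeasurableSet E := Finset.measurableSet_biUnion _ fun l _ => hQmeas l
  refine ⟨m, hQ.pos, E, hEmeas, ?_, fun A hA => ?_, ?_⟩
  · have hdisj : PairwiseDisjoint (↑(Finset.range h)) fun l => T^[l] '' seg p' q' := by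
      have aux : ∀ i j, i < j → j < h → Disjoint (T^[i] '' seg p' q') (T^[j] '' seg p' q') := by
        intro i j hij hj
        rw [Set.disjoint_left]
        rintro _ ⟨x, hx, rfl⟩ ⟨y, hy, hyx⟩
        obtain ⟨k, rfl⟩ := Nat.exists_eq_add_of_le hij.le
        rw [Function.iterate_add_apply] at hyx
        have hyx' := hinj.iterate _ hyx
        exact hP.notMem y (hQP hy) k (by omega) (by omega) (hyx' ▸ hPJ (hQP hx))
      intro i hi j hj hij
      rw [Finset.mem_coe, Finset.mem_range] at hi hj
      rcases lt_or_gt_of_ne hij with hlt | hlt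
      · exact aux i j hlt hj
      · exact (aux j i hlt hi).symm
    rw [hE, measureReal_biUnion_finset hdisj fun l _ => hQmeas l,
      Finset.sum_congr rfl fun l _ => hQm l, Finset.sum_const, Finset.card_range, nsmul_eq_mul]
    calc 1 / K ^ 2 = 1 / K / K := by field_simp
      _ ≤ h * (q - p) / K := by gcongr
      _ = h * ((q - p) / K) := by ring
      _ ≤ h * (q' - p') := by gcongr
  -- Only the top level can leave `E`, and its image has measure `q' - p' ≤ ε`.
  · have hTE : T '' (E ∩ T ⁻¹' A) ⊆ (E ∩ A) ∪ T^[h] '' seg p' q' := by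
      rintro _ ⟨x, ⟨hxE, hxA⟩, rfl⟩
      obtain ⟨l, hl, y, hy, rfl⟩ := mem_iUnion₂.1 hxE
      rw [Finset.mem_range] at hl
      have hstep : T (T^[l] y) = T^[l + 1] y := (Function.iterate_succ_apply' T l y).symm
      rcases Nat.lt_or_ge (l + 1) h with hlt | hge
      · exact Or.inl ⟨mem_biUnion (Finset.mem_coe.2 (Finset.mem_range.2 hlt))
          ⟨y, hy, hstep.symm⟩, hxA⟩
      · have : l + 1 = h := by omega
        exact Or.inr ⟨y, hy, by rw [hstep, this]⟩
    have h1 := (measureReal_mono (μ := lebesgueIco) hTE).trans (measureReal_union_le _ _)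
    rw [hQm, measureReal_def, hmp.measure_image_of_injective hinj
      (hEmeas.inter (hmp.measurable hA)), ← measureReal_def] at h1
    linarith
  · intro x hx
    obtain ⟨l, hl, y, hy, rfl⟩ := mem_iUnion₂.1 hx
    rw [Finset.mem_range] at hl
    have hret := hQ.return_mem y hy
    rw [← Function.iterate_add_apply, Nat.add_comm, Function.iterate_add_apply, Subtype.dist_eq,
      Real.dist_eq, hP.translation l hl.le y (hQP hy) _ hret, abs_le]
    have h1 := hret.1
    have h2 := hret.2
    have h3 := (hQP hy).1
    have h4 := (hQP hy).2
    constructor <;> linarith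

/-- Ergodic transformations of `[0, 1)` are aperiodic. -/
theorem Ergodic.lebesgueIco_setOf_iterate_eq_self (hT : Ergodic T lebesgueIco)
    (hinj : Function.Injective T) {j : ℕ} (hj : 0 < j) :
    lebesgueIco {x | T^[j] x = x} = 0 := by
  have hmp := hT.toMeasurePreserving
  have hPm : MeasurableSet {x | T^[j] x = x} :=
    measurableSet_eq_fun (hmp.measurable.iterate j) measurable_id
  have hinv : T ⁻¹' {x | T^[j] x = x} = {x | T^[j] x = x} := by
    ext x
    rw [mem_preimage, mem_ofPred_eq, mem_ofPred_eq, ← Function.iterate_succ_apply,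
      Function.iterate_succ_apply']
    exact hinj.eq_iff
  rcases hT.toPreErgodic.ae_empty_or_univ hPm hinv with h | h
  · rw [measure_congr h, measure_empty]
  -- Otherwise T^j is the identity almost everywhere, and the first j preimages of a set of measure
  -- 1 / (2j) form an almost invariant union of positive measure at most 1 / 2.
  exfalso
  have hae : ∀ᵐ x ∂lebesgueIco, T^[j] x = x := by
    filter_upwards [h] with x hx
    exact hx.mpr trivial
  have hj' : (0 : ℝ) < j := by exact_mod_cast hj
  have hc0 : (0 : ℝ) < 1 / (2 * j) := by positivity
  have hc1 : 1 / (2 * (j : ℝ)) ≤ 1 := by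
    rw [div_le_one (by positivity)]
    have : (1 : ℝ) ≤ j := by exact_mod_cast hj
    linarith
  set A := seg 0 (1 / (2 * (j : ℝ)))
  have hA : MeasurableSet A := measurableSet_seg _ _
  have hAr : lebesgueIco.real A = 1 / (2 * j) := by
    rw [lebesgueIco_real_seg le_rfl hc0.le hc1, sub_zero]
  set W : Set (Ico (0 : ℝ) 1) := ⋃ i ∈ Finset.range j, T^[i] ⁻¹' A with hW
  have hWm : MeasurableSet W :=
    Finset.measurableSet_biUnion _ fun i _ => (hmp.measurable.iterate i) hA
  have hAW : A ⊆ W := fun x hx => mem_biUnion (Finset.mem_coe.2 (Finset.mem_range.2 hj)) hx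
  have hWle : lebesgueIco.real W ≤ 1 / 2 := by
    refine (measureReal_biUnion_finset_le _ _).trans_eq ?_
    have : ∀ i ∈ Finset.range j, lebesgueIco.real (T^[i] ⁻¹' A) = 1 / (2 * j) := by
      intro i _
      rw [measureReal_def, (hmp.iterate i).measure_preimage hA.nullMeasurableSet, ← measureReal_def,
        hAr]
    rw [Finset.sum_congr rfl this]
    simp only [Finset.sum_const, Finset.card_range, nsmul_eq_mul]
    field_simp
  have hWinv : T ⁻¹' W ≤ᵐ[lebesgueIco] W := by
    filter_upwards [hae] with x hx hxW
    obtain ⟨i, hi, hxi⟩ := mem_iUnion₂.1 (show T x ∈ W from hxW)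
    rw [Finset.mem_range] at hi
    rw [mem_preimage, ← Function.iterate_succ_apply] at hxi
    rcases Nat.lt_or_ge (i + 1) j with hlt | hge
    · exact mem_biUnion (Finset.mem_coe.2 (Finset.mem_range.2 hlt)) hxi
    · have : i.succ = j := by omega
      rw [this, hx] at hxi
      exact hAW hxi
  rcases hT.ae_empty_or_univ_of_preimage_ae_le hWm.nullMeasurableSet hWinv with h' | h'
  · have h1 := measureReal_mono (μ := lebesgueIco) hAW (measure_ne_top _ _)
    rw [measureReal_congr h', measureReal_empty, hAr] at h1
    linarith
  · rw [measureReal_congr h', probReal_univ] at hWle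
    norm_num at hWle

end Towers

/-! ### Interval exchanges are injective piecewise translations -/

namespace IntervalExchangeData

variable {d : ℕ} (D : IntervalExchangeData d)

theorem left_add_length_le {i j : Fin d} (hij : i < j) : D.left i + D.length i ≤ D.left j := by
  rw [left, add_comm, ← Finset.sum_insert (by simp), left]
  refine Finset.sum_le_sum_of_subset_of_nonneg ?_ fun k _ _ => (D.length_pos k).le
  intro k hk
  simp only [Finset.mem_insert, Finset.mem_filter, Finset.mem_univ, true_and] at hk ⊢
  rcases hk with rfl | hk
  · exact hij
  · exact hk.trans hij

/-- The translated intervals do not overlap, which gives injectivity of the exchange. -/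
theorem newLeft_add_length_le {i j : Fin d} (hij : D.perm i < D.perm j) :
    D.newLeft i + D.length i ≤ D.newLeft j := by
  rw [newLeft, add_comm, ← Finset.sum_insert (by simp), newLeft]
  refine Finset.sum_le_sum_of_subset_of_nonneg ?_ fun k _ _ => (D.length_pos k).le
  intro k hk
  simp only [Finset.mem_insert, Finset.mem_filter, Finset.mem_univ, true_and] at hk ⊢
  rcases hk with rfl | hk
  · exact hij
  · exact hk.trans hij

theorem exists_mem_interval {x : ℝ} (hx : x ∈ Ico (0 : ℝ) 1) : ∃ i, x ∈ D.interval i := by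
  have hd : 0 < d := by
    rcases Nat.eq_zero_or_pos d with rfl | h
    · simpa using D.sum_length
    · exact h
  have hne : (Finset.univ.filter fun i => D.left i ≤ x).Nonempty := by
    refine ⟨⟨0, hd⟩, ?_⟩
    have : D.left ⟨0, hd⟩ = 0 := by
      rw [left]
      refine Finset.sum_eq_zero fun j hj => ?_
      have := (Finset.mem_filter.1 hj).2
      exact absurd this (Nat.not_lt_zero _)
    simp [this, hx.1]
  -- The interval containing `x` is the last one starting at or before `x`.
  obtain ⟨i, hi, hmax⟩ := Finset.exists_max_image _ (fun i => i) hne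
  refine ⟨i, (Finset.mem_filter.1 hi).2, ?_⟩
  by_contra hcon
  rw [not_lt, left, add_comm, ← Finset.sum_insert (by simp)] at hcon
  by_cases hlast : i.val + 1 < d
  · have h1 : D.left ⟨i + 1, hlast⟩ ≤ x := by
      refine le_trans (le_of_eq ?_) hcon
      rw [left]
      congr 1
      ext k
      simp only [Finset.mem_insert, Finset.mem_filter, Finset.mem_univ, true_and, Fin.lt_def,
        Fin.ext_iff]
      omega
    have h2 := hmax _ (Finset.mem_filter.2 ⟨Finset.mem_univ _, h1⟩)
    have h3 : i.val + 1 ≤ i.val := h2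
    omega
  · have h1 : insert i (Finset.univ.filter fun j => j < i) = Finset.univ := by
      ext k
      simp only [Finset.mem_insert, Finset.mem_filter, Finset.mem_univ, true_and, Fin.lt_def,
        Fin.ext_iff, iff_true]
      omega
    rw [h1, D.sum_length] at hcon
    exact absurd hx.2 (not_lt.2 hcon)

end IntervalExchangeData

theorem IsIntervalExchange.injective {T : Ico (0 : ℝ) 1 → Ico (0 : ℝ) 1}
    (hT : IsIntervalExchange T) : Function.Injective T := by
  obtain ⟨d, D, hD⟩ := hT
  intro x y hxy
  obtain ⟨i, hi⟩ := D.exists_mem_interval x.2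
  obtain ⟨j, hj⟩ := D.exists_mem_interval y.2
  have h1 := hD i x hi
  have h2 := hD j y hj
  rw [hxy] at h1
  have hi1 := hi.1
  have hi2 := hi.2
  have hj1 := hj.1
  have hj2 := hj.2
  rcases lt_trichotomy (D.perm i) (D.perm j) with h | h | h
  · have := D.newLeft_add_length_le h
    linarith
  · obtain rfl := D.perm.injective h
    exact Subtype.ext (by linarith)
  · have := D.newLeft_add_length_le h
    linarith

theorem IsIntervalExchange.exists_isPiecewiseTranslation {T : Ico (0 : ℝ) 1 → Ico (0 : ℝ) 1}
    (hT : IsIntervalExchange T) : ∃ B, IsPiecewiseTranslation T B := by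
  obtain ⟨d, D, hD⟩ := hT
  refine ⟨Finset.univ.image D.left, fun x y hxy hB => ?_⟩
  obtain ⟨i, hi⟩ := D.exists_mem_interval x.2
  obtain ⟨j, hj⟩ := D.exists_mem_interval y.2
  have hi2 := hi.2
  have hj1 := hj.1
  rcases lt_trichotomy i j with h | rfl | h
  · have h1 := D.left_add_length_le h
    have h2 := hB (D.left j) (Finset.mem_image_of_mem _ (Finset.mem_univ j)) (by linarith)
    linarith
  · rw [hD i x hi, hD i y hj]; ring
  · have h1 := D.left_add_length_le h
    have hi1 := hi.1
    have hj2 := hj.2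
    linarith

theorem proposition6p8 (T : Set.Ico (0 : ℝ) 1 → Set.Ico (0 : ℝ) 1)
    (hT : IsIntervalExchange T) (herg : Ergodic T lebesgueIco) :
    IsPartiallyRigid T lebesgueIco := by
  obtain ⟨B, hB⟩ := hT.exists_isPiecewiseTranslation
  exact isPartiallyRigid_of_almost_invariant herg hT.injective
    (fun _ hj => herg.lebesgueIco_setOf_iterate_eq_self hT.injective hj)
    (show 0 < 1 / ((B.card : ℝ) + 3) ^ 2 by positivity)
    fun _ hε => hB.exists_almost_invariant herg hT.injective hε
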